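/- Let $(C,T_1,T_2,\dots)$ be a sequence of real random variables such that $\mathbb{P}[C\neq 0]>0$ and almost surely only finitely many $T_k$ are nonzero. Let $\mathbb{T}=\bigcup_{n\ge 0}\mathbb{N}^n$ be the infinite Ulam–Harris tree with root $\emptyset$, and let $(C(v),T_1(v),T_2(v),\dots)$, $v\in\mathbb{T}$, be independent copies of $(C,T_1,T_2,\dots)$. Put $L(\emptyset)=1$, $L(vk)=L(v)\,T_k(v)$, and $$W_n=\sum_{k=0}^{n}\ \sum_{|v|=k}L(v)C(v),\qquad n\ge 0 .$$ Suppose that for some $p\in[1,2]$ $$\mathbb{E}C=0,\qquad \mathbb{E}|C|^p<\infty,\qquad \mathbb{E}\sum_{k\ge1}|T_k|^p<1,$$ and that $\mathbb{P}\big[\max_{k\ge 1}|T_k|>1\big]>0$. Then $W_n$ converges almost surely to a real random variable $W$ (the canonical solution of $X\stackrel{d}{=}\sum_{k\ge1}T_kX_k+C$), and $$\mathbb{E}\,e^{\theta|W|}=\infty\qquad\text{for every }\theta>0 .$$ Consequently, the domain $\mathbb{D}_\Psi=\{\theta\in\mathbb{R}:\mathbb{E}e^{\theta W}<\infty\}$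 of the moment generating function of $W$ is not a neighbourhood of $0$, and $\mathbb{D}_\Psi\cap[0,\infty)=\{0\}$ or $\mathbb{D}_\Psi\cap(-\infty,0]=\{0\}$. -/

import Mathlib

open MeasureTheory ProbabilityTheory Filter Topology

noncomputable section

namespace SmoothingTransform

/-- The power sum `Σ_p = ∑ k, |T k| ^ p` of a real sequence, with values in `[0, ∞]`
(for `p > 0` the zero terms do not contribute). -/
def powerSum (p : ℝ) (t : ℕ → ℝ) : ENNReal :=
  ∑' k, ENNReal.ofReal (|t k| ^ p)

/-- The weighted branching model attached to the generic sequence `(C, T 0, T 1, …)` on `(Ω₀, μ)`.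
The vertices of the infinite Ulam-Harris tree are the finite lists of natural numbers, written with
the last letter first: `[]` is the root and `k :: v` is the `k`-th child of `v` (children are
numbered from `0`), so that the length of a list is its generation. `Cv v` is the weight of the
subtree rooted at `v` and `Tv v k` is the weight of the edge from `v` to `k :: v`; the random
sequences `(Cv v, Tv v 0, Tv v 1, …)`, for `v` a vertex, are independent copies of
`(C, T 0, T 1, …)`. -/
structure IsWeightedBranchingModel {Ω₀ Ω : Type*} [MeasurableSpace Ω₀] [MeasurableSpace Ω]
    (μ : Measure Ω₀) (C : Ω₀ → ℝ) (T : ℕ → Ω₀ → ℝ)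
    (P : Measure Ω) (Cv : List ℕ → Ω → ℝ) (Tv : List ℕ → ℕ → Ω → ℝ) : Prop where
  measurable_C : ∀ v, Measurable (Cv v)
  measurable_T : ∀ v k, Measurable (Tv v k)
  identDistrib : ∀ v, IdentDistrib (fun ω => (Cv v ω, fun k => Tv v k ω))
    (fun ω => (C ω, fun k => T k ω)) P μ
  iIndepFun : iIndepFun (fun v ω => (Cv v ω, fun k => Tv v k ω)) P

/-- The total weight `L(v)` of the branch from the root to `v`: the product of the edge weights
along the path. -/
def branchWeight {Ω : Type*} (Tv : List ℕ → ℕ → Ω → ℝ) : List ℕ → Ω → ℝ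
  | [], _ => 1
  | k :: v, ω => branchWeight Tv v ω * Tv v k ω

/-- The contribution `∑_{|v| = n} L(v) C(v)` of generation `n`. Almost surely only finitely many
terms are nonzero when almost surely only finitely many of the `T k` are. -/
def generationSum {Ω : Type*} (Cv : List ℕ → Ω → ℝ) (Tv : List ℕ → ℕ → Ω → ℝ)
    (n : ℕ) (ω : Ω) : ℝ :=
  ∑' v : {v : List ℕ // v.length = n}, branchWeight Tv v ω * Cv v ω

/-- The partial sums `W_n = ∑_{k = 0}^{n} ∑_{|v| = k} L(v) C(v)`. -/
def partialW {Ω : Type*} (Cv : List ℕ → Ω → ℝ) (Tv : List ℕ → ℕ → Ω → ℝ)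
    (n : ℕ) (ω : Ω) : ℝ :=
  ∑ k ∈ Finset.range (n + 1), generationSum Cv Tv k ω

/-- The canonical solution `W = ∑_{k ≥ 0} ∑_{|v| = k} L(v) C(v)`, the pointwise limit of `W_n`
(an irrelevant value where the limit does not exist). -/
def canonicalW {Ω : Type*} (Cv : List ℕ → Ω → ℝ) (Tv : List ℕ → ℕ → Ω → ℝ) (ω : Ω) : ℝ :=
  limUnder atTop (fun n => partialW Cv Tv n ω)

end SmoothingTransform

end

/-! Choose `k` with `|T k| > 1` of positive probability and isolate the `k`-th child in the fixed
point equation: `W = B + T_k W_k`, where `W_k` is a copy of `W` independent of `(B, T_k)`.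
Truncating, `|B| ≤ M` and `|T_k| > 1 + ε` hold together with some probability `δ > 0`, and on this
event large values of `|W_k|` are magnified. Iterating `tail_step` gives `P(|W| > M/ε + (1+ε)^n) ≥
δ^n q`, with `q = P(|W| > M/ε + 1)`. The thresholds grow geometrically while the probabilities decay
only geometrically, so `exp (θ (1+ε)^n) δ^n` is unbounded and every exponential moment of `|W|` is
infinite.

This needs `q > 0`. If `W` were bounded, the same equation would shrink any interval carrying its
law by the factor `1 + ε`, so `W` would be constant. It is not: its mean is zero, so the constant
would be `0`, and the equation would then force `C = 0` almost surely.

Convergence of `W_n` and `E W = 0` come from a von Bahr–Esseen bound: the `p`-th moment of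
generation `n` is at most a constant times `(E ∑ |T k| ^ p) ^ n`, so the `L¹` norms of the
generations are summable. -/

noncomputable section

namespace SmoothingTransform

/-! ### Pointwise expansion of `|a + b| ^ p` for `1 ≤ p ≤ 2` -/

section RealInequalities

/-- For `|x| ≤ 1`, Bernoulli with exponent `p - 1 ∈ [0, 1]` gives `(1 + x)(1 + (p - 1) x) = 1 + p x
+ (p - 1) x ^ 2`, and `x ^ 2 ≤ |x| ^ p`. For `|x| > 1` the last term dominates; `4` covers `2 ^ p`.
-/
lemma abs_one_add_rpow_le {p : ℝ} (hp : p ∈ Set.Icc (1 : ℝ) 2) (x : ℝ) :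
    |1 + x| ^ p ≤ 1 + p * x + 4 * |x| ^ p := by
  obtain ⟨hp1, hp2⟩ := hp
  rcases le_or_gt |x| 1 with hx | hx
  · have hx1 : 0 ≤ 1 + x := by linarith [(abs_le.mp hx).1]
    have hsq : x ^ 2 ≤ |x| ^ p := by
      rw [← sq_abs, ← Real.rpow_two]
      exact Real.rpow_le_rpow_of_exponent_ge_of_imp (abs_nonneg _) hx hp2 (by intro _ h; linarith)
    have h1 : (1 + x) ^ (p - 1) ≤ 1 + (p - 1) * x :=
      rpow_one_add_le_one_add_mul_self (by linarith) (by linarith) (by linarith)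
    have h2 : |1 + x| ^ p = (1 + x) * (1 + x) ^ (p - 1) := by
      rw [abs_of_nonneg hx1]
      conv_lhs => rw [show p = 1 + (p - 1) by ring]
      rw [Real.rpow_add_of_nonneg hx1 zero_le_one (by linarith), Real.rpow_one]
    rw [h2]
    nlinarith [mul_le_mul_of_nonneg_left h1 hx1, sq_nonneg x]
  · have hself : |x| ≤ |x| ^ p := Real.self_le_rpow_of_one_le hx.le hp1
    rcases le_or_gt 0 x with h0 | h0
    · rw [abs_of_nonneg h0] at hx hself ⊢
      have h1 : (1 + x) ^ p ≤ (2 * x) ^ p :=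
        Real.rpow_le_rpow (by linarith) (by linarith) (by linarith)
      have h2 : (2 * x) ^ p ≤ 4 * x ^ p := by
        rw [Real.mul_rpow (by norm_num) h0]
        gcongr
        calc (2 : ℝ) ^ p ≤ 2 ^ (2 : ℝ) := Real.rpow_le_rpow_of_exponent_le (by norm_num) hp2
          _ = 4 := by norm_num
      rw [abs_of_nonneg (by linarith)]
      nlinarith
    · rw [abs_of_neg h0] at hx hself ⊢
      have h1 : |1 + x| ^ p ≤ (-x) ^ p := by
        rw [abs_of_neg (by linarith)]
        exact Real.rpow_le_rpow (by linarith) (by linarith) (by linarith)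
      nlinarith

/-- The derivative of `|x| ^ p`. -/
def absPowDeriv (p a : ℝ) : ℝ := p * (SignType.sign a * |a| ^ (p - 1))

lemma measurable_absPowDeriv (p : ℝ) : Measurable (absPowDeriv p) := by
  have h : Measurable fun a : ℝ => ((SignType.sign a : SignType) : ℝ) := by
    have : (fun a : ℝ => ((SignType.sign a : SignType) : ℝ)) =
        fun a => if 0 < a then 1 else if a < 0 then -1 else 0 := by
      ext a
      rw [sign_apply]
      split_ifs <;> simp
    rw [this]
    exact Measurable.ite measurableSet_Ioi measurable_const
      (Measurable.ite measurableSet_Iio measurable_const measurable_const)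
  unfold absPowDeriv
  fun_prop

/-- By homogeneity and the symmetry `(a, b) ↦ (-a, -b)` this reduces to `a = 1`, apart from `a = 0`.
The middle term is linear in `b`, so it integrates to zero when `b` carries an independent centred
factor. -/
lemma abs_add_rpow_le {p : ℝ} (hp : p ∈ Set.Icc (1 : ℝ) 2) (a b : ℝ) :
    |a + b| ^ p ≤ |a| ^ p + absPowDeriv p a * b + 4 * |b| ^ p := by
  have hp0 : p ≠ 0 := by linarith [hp.1]
  have key : ∀ a b : ℝ, 0 < a →
      |a + b| ^ p ≤ |a| ^ p + p * a ^ (p - 1) * b + 4 * |b| ^ p := by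
    intro a b ha
    have h := mul_le_mul_of_nonneg_left (abs_one_add_rpow_le hp (b / a)) (Real.rpow_nonneg ha.le p)
    have e1 : a ^ p * |1 + b / a| ^ p = |a + b| ^ p := by
      rw [← Real.mul_rpow ha.le (abs_nonneg _)]
      congr 1
      rw [show a + b = a * (1 + b / a) by field_simp, abs_mul, abs_of_pos ha]
    have e2 : a ^ p * |b / a| ^ p = |b| ^ p := by
      rw [← Real.mul_rpow ha.le (abs_nonneg _)]
      congr 1
      rw [abs_div, abs_of_pos ha]
      field_simp
    have e3 : a ^ p * (p * (b / a)) = p * a ^ (p - 1) * b := by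
      rw [Real.rpow_sub_one ha.ne']
      field_simp
    rw [e1] at h
    rw [abs_of_pos ha]
    nlinarith
  rcases lt_trichotomy a 0 with ha | ha | ha
  · have h := key (-a) (-b) (by linarith)
    rw [show -a + -b = -(a + b) by ring, abs_neg, abs_neg, abs_neg] at h
    simp only [absPowDeriv, sign_neg ha, abs_of_neg ha]
    rw [abs_of_neg ha] at h
    simp only [SignType.coe_neg, SignType.coe_one]
    linarith
  · subst ha
    simp [absPowDeriv, Real.zero_rpow hp0]
    have := Real.rpow_nonneg (abs_nonneg b) p
    linarith
  · have h := key a b ha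
    simp only [absPowDeriv, sign_pos ha]
    rw [abs_of_pos ha] at h ⊢
    simp only [SignType.coe_one]
    linarith

/-- Replacing both `|a|` and `|b|` by their maximum gives the bound; `2` comes from `p ≤ 2`. It
makes the linear term integrable. -/
lemma abs_absPowDeriv_mul_le {p : ℝ} (hp : p ∈ Set.Icc (1 : ℝ) 2) (a b : ℝ) :
    |absPowDeriv p a * b| ≤ 2 * (|a| ^ p + |b| ^ p) := by
  have hs : |((SignType.sign a : SignType) : ℝ)| ≤ 1 := by
    rcases lt_trichotomy a 0 with h | h | h <;> simp [h]
  have h1 : |a| ^ (p - 1) * |b| ≤ |a| ^ p + |b| ^ p := by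
    have hM : 0 ≤ max |a| |b| := le_max_of_le_left (abs_nonneg a)
    calc |a| ^ (p - 1) * |b| ≤ max |a| |b| ^ (p - 1) * max |a| |b| := by
          gcongr
          · linarith [hp.1]
          · exact le_max_left _ _
          · exact le_max_right _ _
      _ = max |a| |b| ^ p := by
          conv_rhs => rw [show p = (p - 1) + 1 by ring]
          rw [Real.rpow_add_of_nonneg hM (by linarith [hp.1]) zero_le_one, Real.rpow_one]
      _ ≤ |a| ^ p + |b| ^ p := by
          have := Real.rpow_nonneg (abs_nonneg a) p
          have := Real.rpow_nonneg (abs_nonneg b) p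
          rcases max_cases |a| |b| with ⟨h, _⟩ | ⟨h, _⟩ <;> rw [h] <;> linarith
  have h2 : 0 ≤ |a| ^ (p - 1) * |b| := by positivity
  rw [absPowDeriv, abs_mul, abs_mul, abs_mul, abs_of_nonneg (by linarith [hp.1] : (0 : ℝ) ≤ p),
    abs_of_nonneg (Real.rpow_nonneg (abs_nonneg a) _)]
  calc p * (|((SignType.sign a : SignType) : ℝ)| * |a| ^ (p - 1)) * |b|
      = p * |((SignType.sign a : SignType) : ℝ)| * (|a| ^ (p - 1) * |b|) := by ring
    _ ≤ 2 * 1 * (|a| ^ (p - 1) * |b|) := by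
        gcongr
        exact hp.2
    _ ≤ _ := by linarith

end RealInequalities

/-! ### Adding one martingale difference -/

section MomentStep

variable {Ω : Type*} [MeasurableSpace Ω] {P : Measure Ω}

/-- One step of the von Bahr–Esseen inequality for the martingale difference `L * D`. -/
lemma integral_abs_add_mul_rpow_le {p : ℝ} (hp : p ∈ Set.Icc (1 : ℝ) 2) {S L D : Ω → ℝ}
    (hS : Measurable S) (hL : Measurable L) (hD : Measurable D)
    (hind : IndepFun (fun ω => (S ω, L ω)) D P)
    (hSp : Integrable (fun ω => |S ω| ^ p) P) (hLp : Integrable (fun ω => |L ω| ^ p) P)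
    (hDp : Integrable (fun ω => |D ω| ^ p) P) (hD1 : Integrable D P) (hD0 : ∫ ω, D ω ∂P = 0) :
    Integrable (fun ω => |S ω + L ω * D ω| ^ p) P ∧
      ∫ ω, |S ω + L ω * D ω| ^ p ∂P ≤
        ∫ ω, |S ω| ^ p ∂P + 4 * ((∫ ω, |L ω| ^ p ∂P) * ∫ ω, |D ω| ^ p ∂P) := by
  have hφ := measurable_absPowDeriv p
  have hp0 : 0 ≤ p := by linarith [hp.1]
  have hi1 : IndepFun (fun ω => absPowDeriv p (S ω) * L ω) D P :=
    hind.comp (φ := fun x : ℝ × ℝ => absPowDeriv p x.1 * x.2) (ψ := id) (by fun_prop) measurable_id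
  have hi2 : IndepFun (fun ω => |L ω| ^ p) (fun ω => |D ω| ^ p) P :=
    hind.comp (φ := fun x : ℝ × ℝ => |x.2| ^ p) (ψ := fun x => |x| ^ p) (by fun_prop) (by fun_prop)
  have hint1 : Integrable (fun ω => absPowDeriv p (S ω) * L ω) P := by
    refine ((hSp.add hLp).const_mul 2).mono' (by fun_prop) (ae_of_all _ fun ω => ?_)
    exact abs_absPowDeriv_mul_le hp _ _
  have hint2 : Integrable (fun ω => absPowDeriv p (S ω) * L ω * D ω) P :=
    hi1.integrable_mul hint1 hD1
  have hzero : ∫ ω, absPowDeriv p (S ω) * L ω * D ω ∂P = 0 := by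
    have := hi1.integral_mul_eq_mul_integral (by fun_prop) hD.aestronglyMeasurable
    simp only [Pi.mul_apply] at this
    rw [this, hD0, mul_zero]
  have hint3 : Integrable (fun ω => |L ω| ^ p * |D ω| ^ p) P := hi2.integrable_mul hLp hDp
  have hprod : ∫ ω, |L ω| ^ p * |D ω| ^ p ∂P = (∫ ω, |L ω| ^ p ∂P) * ∫ ω, |D ω| ^ p ∂P := by
    have := hi2.integral_mul_eq_mul_integral (by fun_prop) (by fun_prop)
    simpa only [Pi.mul_apply] using this
  have hbound : ∀ ω, |S ω + L ω * D ω| ^ p ≤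
      |S ω| ^ p + absPowDeriv p (S ω) * L ω * D ω + 4 * (|L ω| ^ p * |D ω| ^ p) := by
    intro ω
    have := abs_add_rpow_le hp (S ω) (L ω * D ω)
    rw [abs_mul, Real.mul_rpow (abs_nonneg _) (abs_nonneg _)] at this
    linarith
  have hintB := (hSp.add hint2).add (hint3.const_mul 4)
  have hintA : Integrable (fun ω => |S ω + L ω * D ω| ^ p) P := by
    refine hintB.mono' (by fun_prop) (ae_of_all _ fun ω => ?_)
    rw [Real.norm_of_nonneg (by positivity)]
    exact hbound ω
  refine ⟨hintA, ?_⟩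
  calc ∫ ω, |S ω + L ω * D ω| ^ p ∂P
      ≤ ∫ ω, (|S ω| ^ p + absPowDeriv p (S ω) * L ω * D ω + 4 * (|L ω| ^ p * |D ω| ^ p)) ∂P :=
        integral_mono hintA hintB hbound
    _ = _ := by
        rw [integral_add (by exact hSp.add hint2) (hint3.const_mul 4), integral_add hSp hint2, hzero,
          integral_const_mul, hprod, add_zero]

end MomentStep

/-! ### Tails of solutions of an affine equation -/

section AffineTail

variable {Ω : Type*} [MeasurableSpace Ω] {P : Measure Ω} {W W' B T : Ω → ℝ}

lemma exists_lt_measure_one_add_lt_abs (hT : 0 < P {ω | 1 < |T ω|}) :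
    ∃ ε : ℝ, 0 < ε ∧ 0 < P {ω | 1 + ε < |T ω|} := by
  have hU : {ω | 1 < |T ω|} ⊆ ⋃ n : ℕ, {ω | 1 + 1 / ((n : ℝ) + 1) < |T ω|} := by
    intro ω hω
    obtain ⟨n, hn⟩ := exists_nat_one_div_lt (sub_pos.mpr (show 1 < |T ω| from hω))
    exact Set.mem_iUnion.mpr ⟨n, show 1 + 1 / ((n : ℝ) + 1) < |T ω| by linarith⟩
  by_contra! h
  refine hT.ne' (measure_mono_null hU (measure_iUnion_null fun n => ?_))
  exact le_antisymm (h _ (by positivity)) zero_le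

/-- On the event for `(B, T)`, `|W| ≥ (1 + ε) |W'| - M`. The offset `M / ε` is the fixed point of `x
↦ (1 + ε) x - M`, so the excess `t` over it is multiplied by exactly `1 + ε` and the step can be
iterated. -/
lemma tail_step (hind : IndepFun (fun ω => (B ω, T ω)) W' P) (hid : IdentDistrib W' W P P)
    (heq : ∀ᵐ ω ∂P, W ω = B ω + T ω * W' ω) {ε M t : ℝ} (hε : 0 < ε) (hM : 0 ≤ M) (ht : 0 ≤ t) :
    P {ω | |B ω| ≤ M ∧ 1 + ε < |T ω|} * P {ω | M / ε + t < |W ω|} ≤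
      P {ω | M / ε + (1 + ε) * t < |W ω|} := by
  have hms1 : MeasurableSet {z : ℝ × ℝ | |z.1| ≤ M ∧ 1 + ε < |z.2|} :=
    (measurableSet_le (f := fun z : ℝ × ℝ => |z.1|) (by fun_prop) measurable_const).inter
      (measurableSet_lt (g := fun z : ℝ × ℝ => |z.2|) measurable_const (by fun_prop))
  have hms2 : MeasurableSet {w : ℝ | M / ε + t < |w|} :=
    measurableSet_lt measurable_const (by fun_prop)
  have h1 := hind.measure_inter_preimage_eq_mul _ _ hms1 hms2
  have h2 : P {ω | M / ε + t < |W ω|} = P (W' ⁻¹' {w : ℝ | M / ε + t < |w|}) :=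
    (hid.measure_mem_eq hms2).symm
  have h3 : P {ω | |B ω| ≤ M ∧ 1 + ε < |T ω|} =
    P ((fun ω => (B ω, T ω)) ⁻¹' {z : ℝ × ℝ | |z.1| ≤ M ∧ 1 + ε < |z.2|}) := rfl
  rw [h2, h3, ← h1]
  refine measure_mono_ae ?_
  filter_upwards [heq] with ω hω hmem
  obtain ⟨⟨hb, hT⟩, hw⟩ := hmem
  simp only [Set.mem_ofPred_eq, Set.mem_preimage] at hb hT hw
  change M / ε + (1 + ε) * t < |W ω|
  have hMe : 0 ≤ M / ε := by positivity
  have hpos : 0 < |W' ω| := by linarith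
  have e1 : (1 + ε) * (M / ε) = M / ε + M := by field_simp
  have e2 : |T ω| * |W' ω| - |B ω| ≤ |W ω| := by
    rw [hω, ← abs_mul]
    have := abs_sub_abs_le_abs_sub (T ω * W' ω) (-B ω)
    rw [abs_neg] at this
    rwa [show B ω + T ω * W' ω = T ω * W' ω - -B ω by ring]
  nlinarith [mul_lt_mul_of_pos_right hT hpos, mul_lt_mul_of_pos_left hw (by linarith : 0 < 1 + ε)]

variable [IsProbabilityMeasure P]

/-- If `W` solves `W = B + T W'` with `W'` a copy of `W` independent of `(B, T)` and `|T| > 1 + ε`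
with positive probability, an interval carrying the law of `W` can be shrunk. -/
lemma exists_shrunk_ball (hB : AEMeasurable B P) (hTm : AEMeasurable T P)
    (hind : IndepFun (fun ω => (B ω, T ω)) W' P) (hid : IdentDistrib W' W P P)
    (heq : ∀ᵐ ω ∂P, W ω = B ω + T ω * W' ω) {ε : ℝ} (hε : 0 < ε)
    (hT : 0 < P {ω | 1 + ε < |T ω|}) {x r : ℝ} (h : ∀ᵐ ω ∂P, |W ω - x| ≤ r) :
    ∃ x', ∀ᵐ ω ∂P, |W ω - x'| ≤ r / (1 + ε) := by
  have hBT : AEMeasurable (fun ω => (B ω, T ω)) P := hB.prodMk hTm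
  have hmap := (indepFun_iff_map_prod_eq_prod_map_map hBT hid.aemeasurable_fst).mp hind
  have : IsProbabilityMeasure (P.map W') := Measure.isProbabilityMeasure_map hid.aemeasurable_fst
  have hms : MeasurableSet {z : (ℝ × ℝ) × ℝ | |z.1.1 + z.1.2 * z.2 - x| ≤ r} :=
    measurableSet_le (by fun_prop) measurable_const
  have h1 : ∀ᵐ z ∂(P.map (fun ω => ((B ω, T ω), W' ω))), |z.1.1 + z.1.2 * z.2 - x| ≤ r := by
    rw [ae_map_iff (hBT.prodMk hid.aemeasurable_fst) hms]
    filter_upwards [h, heq] with ω h1 h2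
    rwa [h2] at h1
  rw [hmap] at h1
  have h2 := ae_of_ae_map hBT (Measure.ae_ae_of_ae_prod h1)
  -- By independence and Fubini, freeze one value of `(B, T)` with `|T| > 1 + ε`; the bound holds
  -- for almost every value of `W'`, and dividing by `T ω` moves the centre and shrinks the radius.
  obtain ⟨ω, hω1, hω2⟩ : ∃ ω, 1 + ε < |T ω| ∧
      ∀ᵐ w ∂(P.map W'), |B ω + T ω * w - x| ≤ r := by
    by_contra! hcon
    refine hT.ne' (measure_mono_null (fun ω hω => ?_) (ae_iff.mp h2))
    exact fun hall => (hcon ω hω) (hall.mono fun _ hw => not_lt.mpr hw)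
  refine ⟨(x - B ω) / T ω, ?_⟩
  have hT0 : 0 < |T ω| := by linarith
  have h3 : ∀ᵐ w ∂(P.map W), |w - (x - B ω) / T ω| ≤ r / (1 + ε) := by
    rw [← hid.map_eq]
    filter_upwards [hω2] with w hw
    have e : w - (x - B ω) / T ω = (B ω + T ω * w - x) / T ω := by
      have : T ω ≠ 0 := abs_pos.mp hT0
      field_simp
      ring
    rw [e, abs_div]
    have hr : 0 ≤ r := (abs_nonneg _).trans hw
    gcongr
  exact ae_of_ae_map hid.aemeasurable_snd h3

lemma ae_eq_const_of_bounded (hB : AEMeasurable B P) (hTm : AEMeasurable T P)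
    (hind : IndepFun (fun ω => (B ω, T ω)) W' P) (hid : IdentDistrib W' W P P)
    (heq : ∀ᵐ ω ∂P, W ω = B ω + T ω * W' ω) {ε : ℝ} (hε : 0 < ε)
    (hT : 0 < P {ω | 1 + ε < |T ω|}) {r : ℝ} (h : ∀ᵐ ω ∂P, |W ω| ≤ r) :
    ∃ c, ∀ᵐ ω ∂P, W ω = c := by
  have hn : ∀ n : ℕ, ∃ x, ∀ᵐ ω ∂P, |W ω - x| ≤ r / (1 + ε) ^ n := by
    intro n
    induction n with
    | zero => exact ⟨0, by simpa using h⟩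
    | succ n ih =>
      obtain ⟨x, hx⟩ := ih
      obtain ⟨x', hx'⟩ := exists_shrunk_ball hB hTm hind hid heq hε hT hx
      exact ⟨x', by simpa only [pow_succ, div_div] using hx'⟩
  choose x hx using hn
  have hlim : Tendsto (fun n : ℕ => r / (1 + ε) ^ n) atTop (𝓝 0) :=
    tendsto_const_nhds.div_atTop (tendsto_pow_atTop_atTop_of_one_lt (by linarith))
  -- The deterministic centres converge to `W ω` for almost every `ω`, so `W` agrees almost surely
  -- with one limit.
  have hconv : ∀ᵐ ω ∂P, Tendsto x atTop (𝓝 (W ω)) := by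
    filter_upwards [ae_all_iff.mpr hx] with ω hω
    rw [tendsto_iff_dist_tendsto_zero]
    refine squeeze_zero (fun _ => dist_nonneg) (fun n => ?_) hlim
    rw [dist_comm, Real.dist_eq]
    exact hω n
  obtain ⟨ω₀, h₀⟩ := hconv.exists
  exact ⟨W ω₀, hconv.mono fun ω hω => tendsto_nhds_unique hω h₀⟩

/-- A nonconstant solution of `W = B + T W'` with `W'` a copy of `W` independent of `(B, T)` has no
exponential moments when `|T| > 1` with positive probability. -/
theorem lintegral_exp_abs_eq_top_of_affine (hB : AEMeasurable B P) (hTm : AEMeasurable T P)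
    (hind : IndepFun (fun ω => (B ω, T ω)) W' P) (hid : IdentDistrib W' W P P)
    (heq : ∀ᵐ ω ∂P, W ω = B ω + T ω * W' ω) (hT : 0 < P {ω | 1 < |T ω|})
    (hconst : ¬ ∃ c, ∀ᵐ ω ∂P, W ω = c) {θ : ℝ} (hθ : 0 < θ) :
    ∫⁻ ω, ENNReal.ofReal (Real.exp (θ * |W ω|)) ∂P = ⊤ := by
  obtain ⟨ε, hε, hTε⟩ := exists_lt_measure_one_add_lt_abs hT
  obtain ⟨M, hδ⟩ : ∃ M : ℕ, 0 < P {ω | |B ω| ≤ M ∧ 1 + ε < |T ω|} := by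
    by_contra! hcon
    refine hTε.ne' (measure_mono_null (t := ⋃ M : ℕ, {ω | |B ω| ≤ M ∧ 1 + ε < |T ω|}) ?_
      (measure_iUnion_null fun M => le_antisymm (hcon M) zero_le))
    intro ω hω
    obtain ⟨n, hn⟩ := exists_nat_ge |B ω|
    exact Set.mem_iUnion.mpr ⟨n, hn, hω⟩
  set δ := P {ω | |B ω| ≤ M ∧ 1 + ε < |T ω|} with hδdef
  set q := P {ω | (M : ℝ) / ε + 1 < |W ω|} with hqdef
  have hq : 0 < q := by
    by_contra! hq
    refine hconst (ae_eq_const_of_bounded hB hTm hind hid heq hε hTε (r := M / ε + 1) ?_)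
    rw [ae_iff]
    simpa only [not_le] using le_antisymm hq zero_le
  have htail : ∀ n : ℕ, δ ^ n * q ≤ P {ω | (M : ℝ) / ε + (1 + ε) ^ n < |W ω|} := by
    intro n
    induction n with
    | zero => simp [hqdef]
    | succ n ih =>
      calc δ ^ (n + 1) * q = δ * (δ ^ n * q) := by ring
        _ ≤ δ * P {ω | (M : ℝ) / ε + (1 + ε) ^ n < |W ω|} := by gcongr
        _ ≤ _ := by
          have := tail_step hind hid heq hε (Nat.cast_nonneg M) (t := (1 + ε) ^ n) (by positivity)
          rwa [← pow_succ'] at this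
  by_contra hfin
  set I := ∫⁻ ω, ENNReal.ofReal (Real.exp (θ * |W ω|)) ∂P with hI
  have hlow : ∀ n : ℕ, ENNReal.ofReal (Real.exp (θ * (1 + ε) ^ n)) * (δ ^ n * q) ≤ I := by
    intro n
    have hWm := hid.aemeasurable_snd
    calc _ ≤ ENNReal.ofReal (Real.exp (θ * (1 + ε) ^ n)) *
          P {ω | ENNReal.ofReal (Real.exp (θ * (1 + ε) ^ n)) ≤
            ENNReal.ofReal (Real.exp (θ * |W ω|))} := by
          gcongr
          refine (htail n).trans (measure_mono fun ω hω => ?_)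
          simp only [Set.mem_ofPred_eq] at hω ⊢
          gcongr
          have : (0 : ℝ) ≤ M / ε := by positivity
          linarith
      _ ≤ I := mul_meas_ge_le_lintegral₀ (by fun_prop) _
  have hδ1 : δ ≠ ⊤ := measure_ne_top _ _
  have hq1 : q ≠ ⊤ := measure_ne_top _ _
  have hδr : 0 < δ.toReal := ENNReal.toReal_pos hδ.ne' hδ1
  have hqr : 0 < q.toReal := ENNReal.toReal_pos hq.ne' hq1
  -- Writing `δ ^ n` as an exponential reduces the claim to `θ (1 + ε) ^ n + n log δ → ∞`.
  have hreal : ∀ n : ℕ, Real.exp (θ * (1 + ε) ^ n + n * Real.log δ.toReal) * q.toReal ≤ I.toReal := by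
    intro n
    have h := ENNReal.toReal_mono hfin (hlow n)
    rw [ENNReal.toReal_mul, ENNReal.toReal_mul, ENNReal.toReal_pow,
      ENNReal.toReal_ofReal (Real.exp_pos _).le] at h
    rwa [Real.exp_add, Real.exp_nat_mul, Real.exp_log hδr, mul_assoc]
  have hdiv : Tendsto (fun n : ℕ => θ * (1 + ε) ^ n + n * Real.log δ.toReal) atTop atTop := by
    have h1 := tendsto_pow_const_div_const_pow_of_one_lt 1 (by linarith : 1 < 1 + ε)
    have h2 : Tendsto (fun n : ℕ => θ + (n : ℝ) ^ 1 / (1 + ε) ^ n * Real.log δ.toReal) atTop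
        (𝓝 θ) := by simpa using (h1.mul_const (Real.log δ.toReal)).const_add θ
    have h3 := (tendsto_pow_atTop_atTop_of_one_lt (by linarith : 1 < 1 + ε)).atTop_mul_pos hθ h2
    refine h3.congr fun n => ?_
    have : (1 + ε) ^ n ≠ 0 := by positivity
    field_simp
  have := (Real.tendsto_exp_atTop.comp hdiv).atTop_mul_const hqr
  obtain ⟨n, hn⟩ := (this.eventually_gt_atTop I.toReal).exists
  exact absurd (hreal n) (not_le.mpr hn)

end AffineTail

/-! ### Measurability, for an arbitrary σ-algebra -/

section Measurability

variable {Ω : Type*} {m : MeasurableSpace Ω}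

variable {Cv : List ℕ → Ω → ℝ} {Tv : List ℕ → ℕ → Ω → ℝ}

/-- `L(v)` uses only edge weights stored at strict ancestors of `v`. Assuming measurability only
there allows a σ-algebra that omits vertices of generation `n`. -/
lemma measurable_branchWeight_of_length_le {n : ℕ}
    (hT : ∀ u : List ℕ, u.length < n → ∀ k, Measurable (Tv u k)) :
    ∀ v : List ℕ, v.length ≤ n → Measurable (branchWeight Tv v)
  | [], _ => measurable_const
  | k :: v, h => by
    have hlt : v.length < n := by simpa using h
    exact (measurable_branchWeight_of_length_le hT v hlt.le).mul (hT v hlt k)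

lemma measurable_branchWeight (hT : ∀ v k, Measurable (Tv v k)) (v : List ℕ) :
    Measurable (branchWeight Tv v) :=
  measurable_branchWeight_of_length_le (n := v.length) (fun u _ => hT u) v le_rfl

lemma measurable_generationSum (hC : ∀ v, Measurable (Cv v)) (hT : ∀ v k, Measurable (Tv v k))
    (n : ℕ) : Measurable (generationSum Cv Tv n) :=
  Measurable.tsum fun v => (measurable_branchWeight hT v).mul (hC v)

lemma measurable_partialW (hC : ∀ v, Measurable (Cv v)) (hT : ∀ v k, Measurable (Tv v k))
    (n : ℕ) : Measurable (partialW Cv Tv n) :=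
  Finset.measurable_fun_sum _ fun k _ => measurable_generationSum hC hT k

lemma measurable_canonicalW (hC : ∀ v, Measurable (Cv v)) (hT : ∀ v k, Measurable (Tv v k)) :
    Measurable (canonicalW Cv Tv) :=
  (StronglyMeasurable.limUnder fun n => (measurable_partialW hC hT n).stronglyMeasurable).measurable

lemma measurable_add_tsum_ite {c : Ω → ℝ} {f : ℕ → Ω → ℝ} {k : ℕ} (hc : Measurable c)
    (hf : ∀ j ≠ k, Measurable (f j)) :
    Measurable fun ω => c ω + ∑' j, if j = k then 0 else f j ω := by
  refine hc.add (Measurable.tsum fun j => ?_)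
  by_cases hj : j = k
  · simp only [hj, if_true]
    exact measurable_const
  · simpa only [hj, if_false] using hf j hj

end Measurability

/-! ### Splitting the tree at the root or at the last generation -/

section Combinatorics

lemma bijective_cons (n : ℕ) : Function.Bijective
    (fun x : ℕ × {v : List ℕ // v.length = n} =>
      (⟨x.1 :: x.2.1, by simp [x.2.2]⟩ : {v : List ℕ // v.length = n + 1})) := by
  constructor
  · rintro ⟨k, v, hv⟩ ⟨k', v', hv'⟩ h
    simpa using h
  · rintro ⟨v, hv⟩
    cases v with
    | nil => simp at hv
    | cons k v => exact ⟨(k, ⟨v, by simpa using hv⟩), rfl⟩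

/-- Since the last letter of a path comes first in the list, `u ++ [k]` is the vertex `u` of the
subtree below child `k` of the root, whereas `k :: v` extends a path by one generation. -/
lemma bijective_snoc (n : ℕ) : Function.Bijective
    (fun x : ℕ × {v : List ℕ // v.length = n} =>
      (⟨x.2.1 ++ [x.1], by simp [x.2.2]⟩ : {v : List ℕ // v.length = n + 1})) := by
  constructor
  · rintro ⟨k, v, hv⟩ ⟨k', v', hv'⟩ h
    simp only [Subtype.mk.injEq] at h
    obtain ⟨h1, h2⟩ := List.append_inj' h rfl
    simp_all
  · rintro ⟨v, hv⟩
    rcases List.eq_nil_or_concat v with rfl | ⟨u, k, rfl⟩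
    · simp at hv
    · exact ⟨(k, ⟨u, by simpa using hv⟩), by simp⟩

variable {Ω : Type*} {Cv : List ℕ → Ω → ℝ} {Tv : List ℕ → ℕ → Ω → ℝ} {ω : Ω}

lemma branchWeight_comp {Ω' : Type*} (g : Ω' → Ω) (v : List ℕ) (x : Ω') :
    branchWeight Tv v (g x) = branchWeight (fun u k y => Tv u k (g y)) v x := by
  induction v with
  | nil => rfl
  | cons k v ih => rw [branchWeight, branchWeight, ih]

lemma branchWeight_append_singleton (v : List ℕ) (k : ℕ) :
    branchWeight Tv (v ++ [k]) ω = Tv [] k ω * branchWeight (fun u => Tv (u ++ [k])) v ω := by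
  induction v with
  | nil => simp [branchWeight]
  | cons j v ih =>
    rw [List.cons_append, branchWeight, branchWeight, ih, mul_assoc]

lemma finite_branchWeight_ne_zero (h : ∀ v, {k | Tv v k ω ≠ 0}.Finite) (n : ℕ) :
    {v : List ℕ | v.length = n ∧ branchWeight Tv v ω ≠ 0}.Finite := by
  induction n with
  | zero =>
    refine (Set.finite_singleton []).subset fun v hv => ?_
    simpa using hv.1
  | succ n ih =>
    refine (ih.biUnion fun v _ => (h v).image fun k => k :: v).subset ?_
    rintro v ⟨hv, hL⟩
    cases v with
    | nil => simp at hv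
    | cons k v =>
      rw [branchWeight] at hL
      refine Set.mem_biUnion (x := v) ⟨by simpa using hv, left_ne_zero_of_mul hL⟩ ?_
      exact ⟨k, right_ne_zero_of_mul hL, rfl⟩

lemma summable_generation (h : ∀ v, {k | Tv v k ω ≠ 0}.Finite) (n : ℕ) :
    Summable fun v : {v : List ℕ // v.length = n} => branchWeight Tv v ω * Cv v ω := by
  refine summable_of_hasFiniteSupport ?_
  refine ((finite_branchWeight_ne_zero h n).preimage
    (Subtype.val_injective (p := fun v : List ℕ => v.length = n)).injOn).subset ?_
  intro v hv
  exact ⟨v.2, left_ne_zero_of_mul hv⟩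

lemma generationSum_zero : generationSum Cv Tv 0 ω = Cv [] ω := by
  unfold generationSum
  rw [tsum_eq_single ⟨[], rfl⟩]
  · simp [branchWeight]
  · rintro ⟨v, hv⟩ hne
    exact absurd (Subtype.ext (List.length_eq_zero_iff.mp hv)) hne

lemma generationSum_succ (h : ∀ v, {k | Tv v k ω ≠ 0}.Finite) (n : ℕ) :
    generationSum Cv Tv (n + 1) ω = ∑' k, Tv [] k ω *
      generationSum (fun u => Cv (u ++ [k])) (fun u => Tv (u ++ [k])) n ω := by
  have hs := summable_generation (Cv := Cv) h (n + 1)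
  have e := (Equiv.ofBijective _ (bijective_snoc n)).tsum_eq
    (fun v : {v : List ℕ // v.length = n + 1} => branchWeight Tv v ω * Cv v ω)
  rw [← (Equiv.ofBijective _ (bijective_snoc n)).summable_iff] at hs
  unfold generationSum
  refine (e.symm.trans hs.tsum_prod).trans (tsum_congr fun k => ?_)
  rw [← tsum_mul_left]
  refine tsum_congr fun v => ?_
  simp only [Function.comp_apply, Equiv.ofBijective_apply, branchWeight_append_singleton]
  ring

lemma partialW_succ (h : ∀ v, {k | Tv v k ω ≠ 0}.Finite) (n : ℕ) :
    partialW Cv Tv (n + 1) ω = Cv [] ω + ∑' k, Tv [] k ω *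
      partialW (fun u => Cv (u ++ [k])) (fun u => Tv (u ++ [k])) n ω := by
  unfold partialW
  rw [Finset.sum_range_succ', add_comm, generationSum_zero]
  congr 1
  simp only [generationSum_succ h, Finset.mul_sum]
  refine (Summable.tsum_finsetSum fun i _ => ?_).symm
  exact summable_of_hasFiniteSupport ((h []).subset fun k hk => left_ne_zero_of_mul hk)

/-- The fixed point equation `W = C + ∑ k, T k * W k`, realised on the tree. -/
lemma canonicalW_eq (h : ∀ v, {k | Tv v k ω ≠ 0}.Finite)
    (hW : Tendsto (fun n => partialW Cv Tv n ω) atTop (𝓝 (canonicalW Cv Tv ω)))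
    (hk : ∀ k, Tendsto (fun n => partialW (fun u => Cv (u ++ [k])) (fun u => Tv (u ++ [k])) n ω) atTop
      (𝓝 (canonicalW (fun u => Cv (u ++ [k])) (fun u => Tv (u ++ [k])) ω))) :
    canonicalW Cv Tv ω = Cv [] ω + ∑' k, Tv [] k ω *
      canonicalW (fun u => Cv (u ++ [k])) (fun u => Tv (u ++ [k])) ω := by
  refine tendsto_nhds_unique ((tendsto_add_atTop_iff_nat 1).mpr hW) ?_
  -- Only finitely many root edges are nonzero, over a set independent of `n`, so the limit passes
  -- through the sum.
  have key : ∀ f : ℕ → ℝ, ∑' k, Tv [] k ω * f k = ∑ k ∈ (h []).toFinset, Tv [] k ω * f k := by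
    intro f
    refine tsum_eq_sum fun k hk => ?_
    have : Tv [] k ω = 0 := by simpa using hk
    rw [this, zero_mul]
  simp only [partialW_succ h, key]
  exact tendsto_const_nhds.add (tendsto_finsetSum _ fun k _ => (hk k).const_mul _)

end Combinatorics

/-! ### Independence and self-similarity of the weighted tree -/

section Model

variable {Ω₀ Ω : Type*} [MeasurableSpace Ω₀] [MeasurableSpace Ω] {μ : Measure Ω₀} {P : Measure Ω}
  {C : Ω₀ → ℝ} {T : ℕ → Ω₀ → ℝ} {Cv : List ℕ → Ω → ℝ} {Tv : List ℕ → ℕ → Ω → ℝ}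

/-- The σ-algebra generated by the weights attached to the vertices in `S`. -/
@[reducible]
def vertexSigma (Cv : List ℕ → Ω → ℝ) (Tv : List ℕ → ℕ → Ω → ℝ) (S : Set (List ℕ)) :
    MeasurableSpace Ω :=
  ⨆ v ∈ S, MeasurableSpace.comap (fun ω => (Cv v ω, fun k => Tv v k ω)) inferInstance

omit [MeasurableSpace Ω] in
lemma measurable_vertexSigma {S : Set (List ℕ)} {v : List ℕ} (hv : v ∈ S) :
    Measurable[vertexSigma Cv Tv S] fun ω => (Cv v ω, fun k => Tv v k ω) :=
  (comap_measurable _).mono (le_iSup₂_of_le v hv le_rfl) le_rfl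

omit [MeasurableSpace Ω] in
lemma measurable_vertexSigma_C {S : Set (List ℕ)} {v : List ℕ} (hv : v ∈ S) :
    Measurable[vertexSigma Cv Tv S] (Cv v) :=
  measurable_fst.comp (measurable_vertexSigma hv)

omit [MeasurableSpace Ω] in
lemma measurable_vertexSigma_T {S : Set (List ℕ)} {v : List ℕ} (hv : v ∈ S) (k : ℕ) :
    Measurable[vertexSigma Cv Tv S] (Tv v k) :=
  (measurable_pi_apply k).comp (measurable_snd.comp (measurable_vertexSigma hv))

namespace IsWeightedBranchingModel

lemma measurable_pair (hm : IsWeightedBranchingModel μ C T P Cv Tv) (v : List ℕ) :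
    Measurable fun ω => (Cv v ω, fun k => Tv v k ω) :=
  (hm.measurable_C v).prodMk (measurable_pi_lambda _ (hm.measurable_T v))

lemma indepFun_of_disjoint (hm : IsWeightedBranchingModel μ C T P Cv Tv) {S U : Set (List ℕ)}
    (hSU : Disjoint S U) {β γ : Type*} [MeasurableSpace β] [MeasurableSpace γ]
    {f : Ω → β} {g : Ω → γ}
    (hf : Measurable[vertexSigma Cv Tv S] f) (hg : Measurable[vertexSigma Cv Tv U] g) :
    IndepFun f g P := by
  rw [IndepFun_iff_Indep]
  have h := indep_iSup_of_disjoint (fun v => (hm.measurable_pair v).comap_le)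
    ((iIndepFun_iff_iIndep _ _ _).mp hm.iIndepFun) hSU
  exact indep_of_indep_of_le_left (indep_of_indep_of_le_right h hg.comap_le) hf.comap_le

lemma identDistrib_C (hm : IsWeightedBranchingModel μ C T P Cv Tv) (v : List ℕ) :
    IdentDistrib (Cv v) C P μ := (hm.identDistrib v).comp measurable_fst

lemma identDistrib_T (hm : IsWeightedBranchingModel μ C T P Cv Tv) (v : List ℕ) :
    IdentDistrib (fun ω k => Tv v k ω) (fun ω k => T k ω) P μ :=
  (hm.identDistrib v).comp measurable_snd

lemma ae_finite (hm : IsWeightedBranchingModel μ C T P Cv Tv)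
    (hN : ∀ᵐ ω ∂μ, {k | T k ω ≠ 0}.Finite) : ∀ᵐ ω ∂P, ∀ v, {k | Tv v k ω ≠ 0}.Finite := by
  refine ae_all_iff.mpr fun v => ?_
  have hms : MeasurableSet {t : ℕ → ℝ | {k | t k ≠ 0}.Finite} := by
    have : {t : ℕ → ℝ | {k | t k ≠ 0}.Finite} = ⋃ N : ℕ, ⋂ k : ℕ, {t | N < k → t k = 0} := by
      ext t
      simp only [Set.mem_ofPred_eq, Set.mem_iUnion, Set.mem_iInter]
      rw [Set.finite_iff_bddAbove]
      refine exists_congr fun N => ⟨fun h k hk => ?_, fun h k hk => ?_⟩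
      · by_contra hne
        exact absurd (h hne) (not_le.mpr hk)
      · by_contra hlt
        exact hk (h k (not_le.mp hlt))
    rw [this]
    refine MeasurableSet.iUnion fun N => MeasurableSet.iInter fun k => ?_
    by_cases hk : N < k
    · simpa [hk] using measurableSet_eq_fun (measurable_pi_apply k) measurable_const
    · simp [hk]
  exact (hm.identDistrib_T v).symm.ae_snd hms hN

/-- The subtree rooted at the `k`-th child of the root. -/
lemma subtree (hm : IsWeightedBranchingModel μ C T P Cv Tv) (k : ℕ) :
    IsWeightedBranchingModel μ C T P (fun u => Cv (u ++ [k])) (fun u => Tv (u ++ [k])) where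
  measurable_C _ := hm.measurable_C _
  measurable_T _ := hm.measurable_T _
  identDistrib _ := hm.identDistrib _
  iIndepFun := hm.iIndepFun.precomp (g := fun u => u ++ [k]) fun _ _ h => List.append_cancel_right h

lemma map_eq_infinitePi [IsProbabilityMeasure P] (hm : IsWeightedBranchingModel μ C T P Cv Tv) :
    P.map (fun ω v => (Cv v ω, fun k => Tv v k ω)) =
      Measure.infinitePi fun _ : List ℕ => μ.map fun ω => (C ω, fun k => T k ω) := by
  rw [(iIndepFun_iff_map_fun_eq_infinitePi_map hm.measurable_pair).mp hm.iIndepFun]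
  congr 1
  ext1 v
  exact (hm.identDistrib v).map_eq

/-- `W` is one fixed measurable functional of the whole family of weights, whose joint law is the
same product measure in both models. -/
lemma identDistrib_canonicalW [IsProbabilityMeasure P]
    {Cv' : List ℕ → Ω → ℝ} {Tv' : List ℕ → ℕ → Ω → ℝ}
    (hm' : IsWeightedBranchingModel μ C T P Cv' Tv')
    (hm : IsWeightedBranchingModel μ C T P Cv Tv) :
    IdentDistrib (canonicalW Cv' Tv') (canonicalW Cv Tv) P P := by
  have h : IdentDistrib (fun ω v => (Cv' v ω, fun k => Tv' v k ω))
      (fun ω v => (Cv v ω, fun k => Tv v k ω)) P P :=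
    ⟨(measurable_pi_lambda _ hm'.measurable_pair).aemeasurable,
      (measurable_pi_lambda _ hm.measurable_pair).aemeasurable,
      hm'.map_eq_infinitePi.trans hm.map_eq_infinitePi.symm⟩
  have hcomp := h.comp (u := canonicalW (Ω := List ℕ → ℝ × (ℕ → ℝ)) (fun v x => (x v).1)
    fun v k x => (x v).2 k) (measurable_canonicalW (fun v => by fun_prop) fun v k => by fun_prop)
  have e : ∀ (c : List ℕ → Ω → ℝ) (t : List ℕ → ℕ → Ω → ℝ),
      canonicalW (Ω := List ℕ → ℝ × (ℕ → ℝ)) (fun v x => (x v).1) (fun v k x => (x v).2 k) ∘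
        (fun ω v => (c v ω, fun k => t v k ω)) = canonicalW c t := by
    intro c t
    ext ω
    simp only [Function.comp_apply, canonicalW, partialW, generationSum,
      branchWeight_comp (Ω := List ℕ → ℝ × (ℕ → ℝ)) (Tv := fun v k x => (x v).2 k)
        (fun ω v => (c v ω, fun k => t v k ω))]
  rwa [e, e] at hcomp

end IsWeightedBranchingModel

end Model

/-! ### Moment bounds, convergence and mean of `W` -/

section Moments

lemma ofReal_abs_rpow {p : ℝ} (hp : 0 ≤ p) (x : ℝ) : ENNReal.ofReal (|x| ^ p) = ‖x‖ₑ ^ p := by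
  rw [Real.enorm_eq_ofReal_abs, ENNReal.ofReal_rpow_of_nonneg (abs_nonneg x) hp]

variable {Ω₀ Ω : Type*} [MeasurableSpace Ω₀] [MeasurableSpace Ω] {μ : Measure Ω₀} {P : Measure Ω}
  {C : Ω₀ → ℝ} {T : ℕ → Ω₀ → ℝ} {Cv : List ℕ → Ω → ℝ} {Tv : List ℕ → ℕ → Ω → ℝ} {p : ℝ}

lemma lintegral_enorm_le_rpow [IsProbabilityMeasure P] (hp : 1 ≤ p) {f : Ω → ℝ}
    (hf : AEStronglyMeasurable f P) :
    ∫⁻ ω, ‖f ω‖ₑ ∂P ≤ (∫⁻ ω, ‖f ω‖ₑ ^ p ∂P) ^ (1 / p) := by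
  have h := eLpNorm_le_eLpNorm_of_exponent_le (p := 1) (q := ENNReal.ofReal p)
    (by simpa using ENNReal.ofReal_le_ofReal hp) hf
  rwa [eLpNorm_one_eq_lintegral_enorm, eLpNorm_eq_lintegral_rpow_enorm_toReal
    (by simpa using by linarith) ENNReal.ofReal_ne_top, ENNReal.toReal_ofReal (by linarith)] at h

namespace IsWeightedBranchingModel

lemma tsum_lintegral_weight (hm : IsWeightedBranchingModel μ C T P Cv Tv) (hp : 0 ≤ p)
    (v : List ℕ) : ∑' k, ∫⁻ ω, ‖Tv v k ω‖ₑ ^ p ∂P = ∫⁻ ω, powerSum p (fun k => T k ω) ∂μ := by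
  have hms : Measurable fun t : ℕ → ℝ => powerSum p t :=
    Measurable.tsum fun k => by fun_prop
  rw [← lintegral_tsum fun k => ((hm.measurable_T v k).enorm.pow_const p).aemeasurable]
  have h := ((hm.identDistrib_T v).comp hms).lintegral_eq
  simp only [Function.comp_def] at h
  rw [← h]
  simp only [powerSum, ofReal_abs_rpow hp]

lemma indepFun_branchWeight (hm : IsWeightedBranchingModel μ C T P Cv Tv) (v : List ℕ) :
    IndepFun (branchWeight Tv v) (fun ω => (Cv v ω, fun k => Tv v k ω)) P :=
  hm.indepFun_of_disjoint (S := {u | u.length < v.length}) (U := {v}) (by simp)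
    (measurable_branchWeight_of_length_le
      (fun _ hu k => measurable_vertexSigma_T hu k) v le_rfl)
    (measurable_vertexSigma (Set.mem_singleton v))

lemma lintegral_branchWeight_cons (hm : IsWeightedBranchingModel μ C T P Cv Tv) (hp : 0 ≤ p)
    (v : List ℕ) (k : ℕ) : ∫⁻ ω, ‖branchWeight Tv (k :: v) ω‖ₑ ^ p ∂P =
      (∫⁻ ω, ‖branchWeight Tv v ω‖ₑ ^ p ∂P) * ∫⁻ ω, ‖Tv v k ω‖ₑ ^ p ∂P := by
  have hL := measurable_branchWeight hm.measurable_T v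
  have hT := hm.measurable_T v k
  have hind : IndepFun (branchWeight Tv v) (Tv v k) P :=
    (hm.indepFun_branchWeight v).comp measurable_id ((measurable_pi_apply k).comp measurable_snd)
  have hφ : Measurable fun x : ℝ => ‖x‖ₑ ^ p := by fun_prop
  have := lintegral_mul_eq_lintegral_mul_lintegral_of_indepFun''
    (hφ.comp hL).aemeasurable (hφ.comp hT).aemeasurable (hind.comp hφ hφ)
  refine Eq.trans (lintegral_congr fun ω => ?_) this
  simp only [Function.comp_apply]
  rw [branchWeight, enorm_mul, ENNReal.mul_rpow_of_nonneg _ _ hp]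

/-- Each new generation multiplies the sum by `E ∑ |T k| ^ p`, because `L(v)` is independent of the
weights at `v`. -/
lemma tsum_lintegral_branchWeight [IsProbabilityMeasure P]
    (hm : IsWeightedBranchingModel μ C T P Cv Tv) (hp : 0 ≤ p) (n : ℕ) :
    ∑' v : {v : List ℕ // v.length = n}, ∫⁻ ω, ‖branchWeight Tv v ω‖ₑ ^ p ∂P =
      (∫⁻ ω, powerSum p (fun k => T k ω) ∂μ) ^ n := by
  induction n with
  | zero =>
    rw [tsum_eq_single ⟨[], rfl⟩]
    · simp [branchWeight]
    · rintro ⟨v, hv⟩ hne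
      exact absurd (Subtype.ext (List.length_eq_zero_iff.mp hv)) hne
  | succ n ih =>
    rw [← (Equiv.ofBijective _ (bijective_cons n)).tsum_eq, ENNReal.tsum_prod', ENNReal.tsum_comm]
    simp only [Equiv.ofBijective_apply, hm.lintegral_branchWeight_cons hp, ENNReal.tsum_mul_left,
      hm.tsum_lintegral_weight hp, ENNReal.tsum_mul_right, ih, pow_succ]

variable [IsProbabilityMeasure P]

lemma integrable_branchWeight_rpow (hm : IsWeightedBranchingModel μ C T P Cv Tv) (hp : 0 ≤ p)
    (hT : ∫⁻ ω, powerSum p (fun k => T k ω) ∂μ < 1) (v : List ℕ) :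
    Integrable (fun ω => |branchWeight Tv v ω| ^ p) P := by
  have hL := measurable_branchWeight hm.measurable_T v
  refine ⟨by fun_prop, ?_⟩
  rw [hasFiniteIntegral_iff_ofReal (ae_of_all _ fun ω => by positivity)]
  simp only [ofReal_abs_rpow hp]
  have h := ENNReal.le_tsum (f := fun u : {u : List ℕ // u.length = v.length} =>
    ∫⁻ ω, ‖branchWeight Tv u ω‖ₑ ^ p ∂P) ⟨v, rfl⟩
  rw [hm.tsum_lintegral_branchWeight hp] at h
  exact h.trans_lt (ENNReal.pow_lt_top (hT.trans ENNReal.one_lt_top))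

/-- Vertices are added one at a time, in any order. Within a generation, `L(w)` and the terms of the
other vertices do not involve the weights at `w`, so each new term is a martingale difference. -/
lemma integral_generation_finset_le (hm : IsWeightedBranchingModel μ C T P Cv Tv)
    (hp : p ∈ Set.Icc (1 : ℝ) 2) (hC0 : ∫ ω, C ω ∂μ = 0) (hC1 : Integrable C μ)
    (hCp : Integrable (fun ω => |C ω| ^ p) μ)
    (hT : ∫⁻ ω, powerSum p (fun k => T k ω) ∂μ < 1) {n : ℕ}
    (F : Finset {v : List ℕ // v.length = n}) :
    Integrable (fun ω => |∑ v ∈ F, branchWeight Tv v ω * Cv v ω| ^ p) P ∧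
      ∫ ω, |∑ v ∈ F, branchWeight Tv v ω * Cv v ω| ^ p ∂P ≤
        4 * (∫ ω, |C ω| ^ p ∂μ) * ∑ v ∈ F, ∫ ω, |branchWeight Tv v ω| ^ p ∂P := by
  classical
  have hp0 : 0 < p := by linarith [hp.1]
  induction F using Finset.induction_on with
  | empty => simp [Real.zero_rpow hp0.ne']
  | insert w F hw ih =>
    have hmL := measurable_branchWeight hm.measurable_T
    have hmS : ∀ G : Finset {v : List ℕ // v.length = n}, Measurable fun ω =>
        ∑ v ∈ G, branchWeight Tv v ω * Cv v ω := fun G =>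
      Finset.measurable_fun_sum _ fun v _ => (hmL v).mul (hm.measurable_C v)
    have hσL : ∀ v : {v : List ℕ // v.length = n},
        Measurable[vertexSigma Cv Tv {u | u ≠ w}] (branchWeight Tv v) := fun v =>
      measurable_branchWeight_of_length_le (n := n) (fun u hu k => measurable_vertexSigma_T
        (by rintro rfl; exact absurd w.2 hu.ne) k) v v.2.le
    have hσS : Measurable[vertexSigma Cv Tv {u | u ≠ w}] fun ω =>
        ∑ v ∈ F, branchWeight Tv v ω * Cv v ω :=
      Finset.measurable_fun_sum _ fun v hv => (hσL v).mul (measurable_vertexSigma_C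
        (by intro h; exact hw (Subtype.ext h ▸ hv)))
    have hind : IndepFun (fun ω => (∑ v ∈ F, branchWeight Tv v ω * Cv v ω, branchWeight Tv w ω))
        (Cv w) P :=
      hm.indepFun_of_disjoint (U := {w.1}) (by simp) (hσS.prodMk (hσL w))
        (measurable_vertexSigma_C rfl)
    have hidC := hm.identDistrib_C w
    have hidCp : IdentDistrib (fun ω => |Cv w ω| ^ p) (fun ω => |C ω| ^ p) P μ :=
      hidC.comp (u := fun x => |x| ^ p) (by fun_prop)
    have h := integral_abs_add_mul_rpow_le hp (hmS F) (hmL w) (hm.measurable_C w) hind ih.1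
      (hm.integrable_branchWeight_rpow hp0.le hT w) (hidCp.integrable_iff.mpr hCp)
      (hidC.integrable_iff.mpr hC1) (hidC.integral_eq.trans hC0)
    simp only [Finset.sum_insert hw]
    simp only [add_comm (branchWeight Tv w _ * Cv w _)]
    refine ⟨h.1, h.2.trans ?_⟩
    rw [hidCp.integral_eq]
    linarith [ih.2]

lemma lintegral_generation_finset_le (hm : IsWeightedBranchingModel μ C T P Cv Tv)
    (hp : p ∈ Set.Icc (1 : ℝ) 2) (hC0 : ∫ ω, C ω ∂μ = 0) (hC1 : Integrable C μ)
    (hCp : Integrable (fun ω => |C ω| ^ p) μ)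
    (hT : ∫⁻ ω, powerSum p (fun k => T k ω) ∂μ < 1) {n : ℕ}
    (F : Finset {v : List ℕ // v.length = n}) :
    ∫⁻ ω, ‖∑ v ∈ F, branchWeight Tv v ω * Cv v ω‖ₑ ^ p ∂P ≤
      ENNReal.ofReal (4 * ∫ ω, |C ω| ^ p ∂μ) *
        ∑ v ∈ F, ∫⁻ ω, ‖branchWeight Tv v ω‖ₑ ^ p ∂P := by
  have hp0 : 0 ≤ p := by linarith [hp.1]
  have h := hm.integral_generation_finset_le hp hC0 hC1 hCp hT F
  have hc : 0 ≤ ∫ ω, |C ω| ^ p ∂μ := integral_nonneg fun ω => by positivity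
  simp only [← ofReal_abs_rpow hp0]
  rw [← ofReal_integral_eq_lintegral_ofReal h.1 (ae_of_all _ fun ω => by positivity)]
  refine (ENNReal.ofReal_le_ofReal h.2).trans_eq ?_
  rw [ENNReal.ofReal_mul (by positivity),
    ENNReal.ofReal_sum_of_nonneg fun v _ => integral_nonneg fun ω => by positivity]
  congr 1
  refine Finset.sum_congr rfl fun v _ => ?_
  exact ofReal_integral_eq_lintegral_ofReal (hm.integrable_branchWeight_rpow hp0 hT v)
    (ae_of_all _ fun ω => by positivity)

/-- Fatou's lemma along the finite sets containing `F`. Taking `F = ∅` bounds the whole generation;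
letting `F` grow gives convergence of its finite partial sums. -/
lemma lintegral_generationSum_sub_le (hm : IsWeightedBranchingModel μ C T P Cv Tv)
    (hN : ∀ᵐ ω ∂μ, {k | T k ω ≠ 0}.Finite)
    (hp : p ∈ Set.Icc (1 : ℝ) 2) (hC0 : ∫ ω, C ω ∂μ = 0) (hC1 : Integrable C μ)
    (hCp : Integrable (fun ω => |C ω| ^ p) μ)
    (hT : ∫⁻ ω, powerSum p (fun k => T k ω) ∂μ < 1) {n : ℕ}
    (F : Finset {v : List ℕ // v.length = n}) :
    ∫⁻ ω, ‖generationSum Cv Tv n ω - ∑ v ∈ F, branchWeight Tv v ω * Cv v ω‖ₑ ^ p ∂P ≤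
      ENNReal.ofReal (4 * ∫ ω, |C ω| ^ p ∂μ) *
        ∑' v : {v // v ∉ F}, ∫⁻ ω, ‖branchWeight Tv v ω‖ₑ ^ p ∂P := by
  classical
  have hmS : ∀ G : Finset {v : List ℕ // v.length = n}, Measurable fun ω =>
      ∑ v ∈ G, branchWeight Tv v ω * Cv v ω := fun G =>
    Finset.measurable_fun_sum _ fun v _ =>
      (measurable_branchWeight hm.measurable_T v).mul (hm.measurable_C v)
  calc _ ≤ ∫⁻ ω, liminf (fun G : Finset {v : List ℕ // v.length = n} =>
        ‖∑ v ∈ G, branchWeight Tv v ω * Cv v ω - ∑ v ∈ F, branchWeight Tv v ω * Cv v ω‖ₑ ^ p)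
          atTop ∂P := by
        refine lintegral_mono_ae ?_
        filter_upwards [hm.ae_finite hN] with ω hω
        have hsum : Tendsto (fun G : Finset {v : List ℕ // v.length = n} =>
            ∑ v ∈ G, branchWeight Tv v ω * Cv v ω) atTop (𝓝 (generationSum Cv Tv n ω)) :=
          (summable_generation hω n).hasSum
        refine le_of_eq (Tendsto.liminf_eq ?_).symm
        exact ((hsum.sub_const _).enorm).ennrpow_const p
    _ ≤ liminf (fun G : Finset {v : List ℕ // v.length = n} => ∫⁻ ω,
        ‖∑ v ∈ G, branchWeight Tv v ω * Cv v ω - ∑ v ∈ F, branchWeight Tv v ω * Cv v ω‖ₑ ^ p ∂P)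
          atTop :=
        lintegral_liminf_le' fun G =>
          ((((hmS G).sub (hmS F)).enorm).pow_const p).aemeasurable
    _ ≤ _ := by
        refine liminf_le_of_frequently_le' (Eventually.frequently ?_)
        filter_upwards [eventually_ge_atTop F] with G hG
        have e : ∀ ω, ∑ v ∈ G, branchWeight Tv v ω * Cv v ω -
            ∑ v ∈ F, branchWeight Tv v ω * Cv v ω =
            ∑ v ∈ G \ F, branchWeight Tv v ω * Cv v ω := fun ω => by
          rw [← Finset.sum_sdiff hG, add_sub_cancel_right]
        simp only [e]
        refine (hm.lintegral_generation_finset_le hp hC0 hC1 hCp hT _).trans ?_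
        gcongr
        have h1 : ∀ v ∈ G \ F, v ∉ F := fun v hv => (Finset.mem_sdiff.mp hv).2
        rw [← Finset.sum_subtype_of_mem (p := fun v => v ∉ F)
          (fun v : {v : List ℕ // v.length = n} => ∫⁻ ω, ‖branchWeight Tv v ω‖ₑ ^ p ∂P) h1]
        exact ENNReal.sum_le_tsum _

lemma lintegral_generationSum_le (hm : IsWeightedBranchingModel μ C T P Cv Tv)
    (hN : ∀ᵐ ω ∂μ, {k | T k ω ≠ 0}.Finite)
    (hp : p ∈ Set.Icc (1 : ℝ) 2) (hC0 : ∫ ω, C ω ∂μ = 0) (hC1 : Integrable C μ)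
    (hCp : Integrable (fun ω => |C ω| ^ p) μ)
    (hT : ∫⁻ ω, powerSum p (fun k => T k ω) ∂μ < 1) (n : ℕ) :
    ∫⁻ ω, ‖generationSum Cv Tv n ω‖ₑ ∂P ≤ ENNReal.ofReal (4 * ∫ ω, |C ω| ^ p ∂μ) ^ (1 / p) *
      ((∫⁻ ω, powerSum p (fun k => T k ω) ∂μ) ^ (1 / p)) ^ n := by
  have hp0 : 0 ≤ p := by linarith [hp.1]
  have h := hm.lintegral_generationSum_sub_le hN hp hC0 hC1 hCp hT
    (∅ : Finset {v : List ℕ // v.length = n})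
  have e : ∑' v : {v // v ∉ (∅ : Finset {v : List ℕ // v.length = n})},
      ∫⁻ ω, ‖branchWeight Tv v ω‖ₑ ^ p ∂P = (∫⁻ ω, powerSum p (fun k => T k ω) ∂μ) ^ n := by
    rw [← hm.tsum_lintegral_branchWeight hp0 n]
    exact (Equiv.subtypeUnivEquiv (p := fun v : {v : List ℕ // v.length = n} => v ∉ ∅)
      (fun v => Finset.notMem_empty v)).tsum_eq
      (fun v => ∫⁻ ω, ‖branchWeight Tv v ω‖ₑ ^ p ∂P)
  simp only [Finset.sum_empty, sub_zero] at h
  rw [e] at h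
  calc _ ≤ (∫⁻ ω, ‖generationSum Cv Tv n ω‖ₑ ^ p ∂P) ^ (1 / p) :=
        lintegral_enorm_le_rpow hp.1
          (measurable_generationSum hm.measurable_C hm.measurable_T n).aestronglyMeasurable
    _ ≤ _ := ENNReal.rpow_le_rpow h (by positivity)
    _ = _ := by
        rw [ENNReal.mul_rpow_of_nonneg _ _ (by positivity), ← ENNReal.rpow_natCast,
          ← ENNReal.rpow_natCast, ← ENNReal.rpow_mul, ← ENNReal.rpow_mul, mul_comm (n : ℝ)]

lemma tsum_lintegral_generationSum_lt_top (hm : IsWeightedBranchingModel μ C T P Cv Tv)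
    (hN : ∀ᵐ ω ∂μ, {k | T k ω ≠ 0}.Finite)
    (hp : p ∈ Set.Icc (1 : ℝ) 2) (hC0 : ∫ ω, C ω ∂μ = 0) (hC1 : Integrable C μ)
    (hCp : Integrable (fun ω => |C ω| ^ p) μ)
    (hT : ∫⁻ ω, powerSum p (fun k => T k ω) ∂μ < 1) :
    ∑' n, ∫⁻ ω, ‖generationSum Cv Tv n ω‖ₑ ∂P < ⊤ := by
  have hp0 : 0 < 1 / p := by have := hp.1; positivity
  refine (ENNReal.tsum_le_tsum (hm.lintegral_generationSum_le hN hp hC0 hC1 hCp hT)).trans_lt ?_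
  rw [ENNReal.tsum_mul_left, ENNReal.tsum_geometric]
  refine ENNReal.mul_lt_top (ENNReal.rpow_lt_top_of_nonneg hp0.le ENNReal.ofReal_ne_top) ?_
  rw [ENNReal.inv_lt_top, tsub_pos_iff_lt]
  exact ENNReal.rpow_lt_one hT hp0

lemma integrable_generationSum (hm : IsWeightedBranchingModel μ C T P Cv Tv)
    (hN : ∀ᵐ ω ∂μ, {k | T k ω ≠ 0}.Finite)
    (hp : p ∈ Set.Icc (1 : ℝ) 2) (hC0 : ∫ ω, C ω ∂μ = 0) (hC1 : Integrable C μ)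
    (hCp : Integrable (fun ω => |C ω| ^ p) μ)
    (hT : ∫⁻ ω, powerSum p (fun k => T k ω) ∂μ < 1) (n : ℕ) :
    Integrable (generationSum Cv Tv n) P :=
  ⟨(measurable_generationSum hm.measurable_C hm.measurable_T n).aestronglyMeasurable,
    (ENNReal.le_tsum n).trans_lt (hm.tsum_lintegral_generationSum_lt_top hN hp hC0 hC1 hCp hT)⟩

/-- For `p > 1` the sum of `E |L(v) C(v)|` over a generation may diverge, so Fubini is unavailable;
the mean is instead passed through the `L¹` limit of finite partial sums. -/
lemma integral_generationSum (hm : IsWeightedBranchingModel μ C T P Cv Tv)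
    (hN : ∀ᵐ ω ∂μ, {k | T k ω ≠ 0}.Finite)
    (hp : p ∈ Set.Icc (1 : ℝ) 2) (hC0 : ∫ ω, C ω ∂μ = 0) (hC1 : Integrable C μ)
    (hCp : Integrable (fun ω => |C ω| ^ p) μ)
    (hT : ∫⁻ ω, powerSum p (fun k => T k ω) ∂μ < 1) (n : ℕ) :
    ∫ ω, generationSum Cv Tv n ω ∂P = 0 := by
  have hp0 : 0 < p := by linarith [hp.1]
  have hmL := measurable_branchWeight hm.measurable_T
  have hL1 : ∀ v, Integrable (branchWeight Tv v) P := fun v => by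
    refine ⟨(hmL v).aestronglyMeasurable, (lintegral_enorm_le_rpow hp.1
      (hmL v).aestronglyMeasurable).trans_lt (ENNReal.rpow_lt_top_of_nonneg (by positivity) ?_)⟩
    have h := hm.integrable_branchWeight_rpow hp0.le hT v
    have h2 := (hasFiniteIntegral_iff_ofReal (ae_of_all _ fun ω => by positivity)).mp h.2
    simpa only [ofReal_abs_rpow hp0.le] using h2.ne
  have hind : ∀ v, IndepFun (branchWeight Tv v) (Cv v) P := fun v =>
    (hm.indepFun_branchWeight v).comp measurable_id measurable_fst
  have hLC : ∀ v, Integrable (fun ω => branchWeight Tv v ω * Cv v ω) P := fun v =>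
    (hind v).integrable_mul (hL1 v) ((hm.identDistrib_C v).integrable_iff.mpr hC1)
  have hLC0 : ∀ v, ∫ ω, branchWeight Tv v ω * Cv v ω ∂P = 0 := fun v => by
    have := (hind v).integral_mul_eq_mul_integral (hmL v).aestronglyMeasurable
      (hm.measurable_C v).aestronglyMeasurable
    simp only [Pi.mul_apply] at this
    rw [this, (hm.identDistrib_C v).integral_eq, hC0, mul_zero]
  have hmS : ∀ G : Finset {v : List ℕ // v.length = n}, Measurable fun ω =>
      ∑ v ∈ G, branchWeight Tv v ω * Cv v ω := fun G =>
    Finset.measurable_fun_sum _ fun v _ => (hmL v).mul (hm.measurable_C v)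
  have hmg := measurable_generationSum hm.measurable_C hm.measurable_T n
  have hlim : Tendsto (fun F : Finset {v : List ℕ // v.length = n} => ∫⁻ ω,
      ‖∑ v ∈ F, branchWeight Tv v ω * Cv v ω - generationSum Cv Tv n ω‖ₑ ∂P) atTop (𝓝 0) := by
    have hne : ∑' v : {v : List ℕ // v.length = n}, ∫⁻ ω, ‖branchWeight Tv v ω‖ₑ ^ p ∂P ≠ ⊤ := by
      rw [hm.tsum_lintegral_branchWeight hp0.le]
      exact (ENNReal.pow_lt_top (hT.trans ENNReal.one_lt_top)).ne
    have h1 := (ENNReal.Tendsto.const_mul (a := ENNReal.ofReal (4 * ∫ ω, |C ω| ^ p ∂μ))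
      (ENNReal.tendsto_tsum_compl_atTop_zero hne) (Or.inr ENNReal.ofReal_ne_top)).ennrpow_const
        (1 / p)
    rw [mul_zero, ENNReal.zero_rpow_of_pos (by positivity)] at h1
    refine tendsto_of_tendsto_of_tendsto_of_le_of_le tendsto_const_nhds h1 (fun _ => zero_le)
      fun F => ?_
    simp only [enorm_sub_rev (∑ v ∈ F, branchWeight Tv v _ * Cv v _)]
    exact (lintegral_enorm_le_rpow hp.1 (hmg.sub (hmS F)).aestronglyMeasurable).trans
      (ENNReal.rpow_le_rpow (hm.lintegral_generationSum_sub_le hN hp hC0 hC1 hCp hT F)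
        (by positivity))
  have hlim2 := tendsto_integral_of_L1 _ hmg.aestronglyMeasurable
    (Eventually.of_forall fun F => integrable_finsetSum F fun v _ => hLC v.1) hlim
  refine tendsto_nhds_unique hlim2 ?_
  have : ∀ F : Finset {v : List ℕ // v.length = n},
      ∫ ω, ∑ v ∈ F, branchWeight Tv v ω * Cv v ω ∂P = 0 := fun F => by
    rw [integral_finsetSum _ fun v _ => hLC v.1]
    simp [hLC0]
  simp only [this]
  exact tendsto_const_nhds

lemma ae_summable_generationSum (hm : IsWeightedBranchingModel μ C T P Cv Tv)
    (hN : ∀ᵐ ω ∂μ, {k | T k ω ≠ 0}.Finite)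
    (hp : p ∈ Set.Icc (1 : ℝ) 2) (hC0 : ∫ ω, C ω ∂μ = 0) (hC1 : Integrable C μ)
    (hCp : Integrable (fun ω => |C ω| ^ p) μ)
    (hT : ∫⁻ ω, powerSum p (fun k => T k ω) ∂μ < 1) :
    ∀ᵐ ω ∂P, Summable fun n => generationSum Cv Tv n ω := by
  have hmg := measurable_generationSum hm.measurable_C hm.measurable_T
  have h := hm.tsum_lintegral_generationSum_lt_top hN hp hC0 hC1 hCp hT
  rw [← lintegral_tsum fun n => (hmg n).enorm.aemeasurable] at h
  filter_upwards [ae_lt_top (Measurable.tsum fun n => (hmg n).enorm) h.ne] with ω hω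
  exact Summable.of_enorm hω.ne

lemma ae_tendsto_partialW (hm : IsWeightedBranchingModel μ C T P Cv Tv)
    (hN : ∀ᵐ ω ∂μ, {k | T k ω ≠ 0}.Finite)
    (hp : p ∈ Set.Icc (1 : ℝ) 2) (hC0 : ∫ ω, C ω ∂μ = 0) (hC1 : Integrable C μ)
    (hCp : Integrable (fun ω => |C ω| ^ p) μ)
    (hT : ∫⁻ ω, powerSum p (fun k => T k ω) ∂μ < 1) :
    ∀ᵐ ω ∂P, Tendsto (fun n => partialW Cv Tv n ω) atTop (𝓝 (canonicalW Cv Tv ω)) := by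
  filter_upwards [hm.ae_summable_generationSum hN hp hC0 hC1 hCp hT] with ω hω
  -- The shift by one appears because `partialW` at `n` sums `n + 1` generations.
  exact tendsto_nhds_limUnder ⟨_, (tendsto_add_atTop_iff_nat 1).mpr hω.hasSum.tendsto_sum_nat⟩

lemma integral_canonicalW (hm : IsWeightedBranchingModel μ C T P Cv Tv)
    (hN : ∀ᵐ ω ∂μ, {k | T k ω ≠ 0}.Finite)
    (hp : p ∈ Set.Icc (1 : ℝ) 2) (hC0 : ∫ ω, C ω ∂μ = 0) (hC1 : Integrable C μ)
    (hCp : Integrable (fun ω => |C ω| ^ p) μ)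
    (hT : ∫⁻ ω, powerSum p (fun k => T k ω) ∂μ < 1) :
    ∫ ω, canonicalW Cv Tv ω ∂P = 0 := by
  have hsum : Summable fun n => ∫ ω, ‖generationSum Cv Tv n ω‖ ∂P := by
    refine (ENNReal.summable_toReal
      (hm.tsum_lintegral_generationSum_lt_top hN hp hC0 hC1 hCp hT).ne).congr fun n => ?_
    rw [integral_norm_eq_lintegral_enorm
      (measurable_generationSum hm.measurable_C hm.measurable_T n).aestronglyMeasurable]
  have h := hasSum_integral_of_summable_integral_norm
    (hm.integrable_generationSum hN hp hC0 hC1 hCp hT) hsum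
  simp only [hm.integral_generationSum hN hp hC0 hC1 hCp hT] at h
  rw [← h.unique hasSum_zero]
  refine integral_congr_ae ?_
  filter_upwards [hm.ae_summable_generationSum hN hp hC0 hC1 hCp hT] with ω hω
  exact ((tendsto_add_atTop_iff_nat 1).mpr hω.hasSum.tendsto_sum_nat).limUnder_eq

end IsWeightedBranchingModel

end Moments

/-! ### Nondegeneracy and exponential moments of `W` -/

section ExponentialMoments

variable {Ω₀ Ω : Type*} [MeasurableSpace Ω₀] [MeasurableSpace Ω] {μ : Measure Ω₀} {P : Measure Ω}
  [IsProbabilityMeasure P] {C : Ω₀ → ℝ} {T : ℕ → Ω₀ → ℝ} {Cv : List ℕ → Ω → ℝ}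
  {Tv : List ℕ → ℕ → Ω → ℝ} {p : ℝ}

namespace IsWeightedBranchingModel

lemma ae_canonicalW_eq (hm : IsWeightedBranchingModel μ C T P Cv Tv)
    (hN : ∀ᵐ ω ∂μ, {k | T k ω ≠ 0}.Finite)
    (hp : p ∈ Set.Icc (1 : ℝ) 2) (hC0 : ∫ ω, C ω ∂μ = 0) (hC1 : Integrable C μ)
    (hCp : Integrable (fun ω => |C ω| ^ p) μ)
    (hT : ∫⁻ ω, powerSum p (fun k => T k ω) ∂μ < 1) :
    ∀ᵐ ω ∂P, {k | Tv [] k ω ≠ 0}.Finite ∧ canonicalW Cv Tv ω = Cv [] ω + ∑' k, Tv [] k ω *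
      canonicalW (fun u => Cv (u ++ [k])) (fun u => Tv (u ++ [k])) ω := by
  filter_upwards [hm.ae_finite hN, hm.ae_tendsto_partialW hN hp hC0 hC1 hCp hT,
    ae_all_iff.mpr fun k => (hm.subtree k).ae_tendsto_partialW hN hp hC0 hC1 hCp hT] with ω h1 h2 h3
  exact ⟨h1 [], canonicalW_eq h1 h2 h3⟩

/-- `W` is not almost surely constant. -/
lemma not_ae_eq_const (hm : IsWeightedBranchingModel μ C T P Cv Tv)
    (hN : ∀ᵐ ω ∂μ, {k | T k ω ≠ 0}.Finite) (hC : 0 < μ {ω | C ω ≠ 0})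
    (hp : p ∈ Set.Icc (1 : ℝ) 2) (hC0 : ∫ ω, C ω ∂μ = 0) (hC1 : Integrable C μ)
    (hCp : Integrable (fun ω => |C ω| ^ p) μ)
    (hT : ∫⁻ ω, powerSum p (fun k => T k ω) ∂μ < 1) :
    ¬ ∃ c, ∀ᵐ ω ∂P, canonicalW Cv Tv ω = c := by
  rintro ⟨c, hc⟩
  have h0 := hm.integral_canonicalW hN hp hC0 hC1 hCp hT
  rw [integral_congr_ae hc, integral_const, probReal_univ, one_smul] at h0
  subst h0
  have hk : ∀ k, ∀ᵐ ω ∂P,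
      canonicalW (fun u => Cv (u ++ [k])) (fun u => Tv (u ++ [k])) ω = 0 := fun k =>
    ((hm.subtree k).identDistrib_canonicalW hm).symm.ae_snd (p := fun x => x = 0)
      (measurableSet_singleton 0) hc
  have hCv : ∀ᵐ ω ∂P, Cv [] ω = 0 := by
    filter_upwards [hm.ae_canonicalW_eq hN hp hC0 hC1 hCp hT, hc, ae_all_iff.mpr hk]
      with ω h1 h2 h3
    simpa [h2, h3] using h1.2.symm
  exact hC.ne' (ae_iff.mp ((hm.identDistrib_C []).ae_snd (p := fun x => x = 0)
    (measurableSet_singleton 0) hCv))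

lemma lintegral_exp_abs_canonicalW (hm : IsWeightedBranchingModel μ C T P Cv Tv)
    (hN : ∀ᵐ ω ∂μ, {k | T k ω ≠ 0}.Finite) (hC : 0 < μ {ω | C ω ≠ 0})
    (hp : p ∈ Set.Icc (1 : ℝ) 2) (hC0 : ∫ ω, C ω ∂μ = 0) (hC1 : Integrable C μ)
    (hCp : Integrable (fun ω => |C ω| ^ p) μ)
    (hT : ∫⁻ ω, powerSum p (fun k => T k ω) ∂μ < 1) {k : ℕ} (hk : 0 < μ {ω | 1 < |T k ω|})
    {θ : ℝ} (hθ : 0 < θ) :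
    ∫⁻ ω, ENNReal.ofReal (Real.exp (θ * |canonicalW Cv Tv ω|)) ∂P = ⊤ := by
  set Wk : ℕ → Ω → ℝ := fun j => canonicalW (fun u => Cv (u ++ [j])) (fun u => Tv (u ++ [j]))
    with hWk
  set B : Ω → ℝ := fun ω => Cv [] ω + ∑' j, if j = k then 0 else Tv [] j ω * Wk j ω with hB
  -- `S` is the subtree below child `k`. The root and all other subtrees lie in its complement,
  -- which determines `(B, T_k)`; hence the independence from `W_k`.
  set S : Set (List ℕ) := {u | ∃ v, u = v ++ [k]} with hS
  have hnil : ([] : List ℕ) ∈ Sᶜ := by simp [hS]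
  have hσB : Measurable[vertexSigma Cv Tv Sᶜ] B := by
    refine measurable_add_tsum_ite (measurable_vertexSigma_C hnil) fun j hj => ?_
    have hmem : ∀ v : List ℕ, v ++ [j] ∈ Sᶜ := by
      rintro v ⟨w, hw⟩
      exact hj (by simpa using (List.append_inj' hw rfl).2)
    exact (measurable_vertexSigma_T hnil j).mul (measurable_canonicalW
      (fun v => measurable_vertexSigma_C (hmem v)) fun v i => measurable_vertexSigma_T (hmem v) i)
  have hσW : Measurable[vertexSigma Cv Tv S] (Wk k) :=
    have hmem : ∀ v : List ℕ, v ++ [k] ∈ S := fun v => ⟨v, rfl⟩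
    measurable_canonicalW (fun v => measurable_vertexSigma_C (hmem v))
      fun v i => measurable_vertexSigma_T (hmem v) i
  have hle : vertexSigma Cv Tv Sᶜ ≤ ‹MeasurableSpace Ω› :=
    iSup₂_le fun v _ => (hm.measurable_pair v).comap_le
  have hind : IndepFun (fun ω => (B ω, Tv [] k ω)) (Wk k) P :=
    hm.indepFun_of_disjoint disjoint_compl_left
      (hσB.prodMk (measurable_vertexSigma_T hnil k)) hσW
  have heq : ∀ᵐ ω ∂P, canonicalW Cv Tv ω = B ω + Tv [] k ω * Wk k ω := by
    filter_upwards [hm.ae_canonicalW_eq hN hp hC0 hC1 hCp hT] with ω hω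
    have hs : Summable fun j => Tv [] j ω * Wk j ω :=
      summable_of_hasFiniteSupport (hω.1.subset fun j hj => left_ne_zero_of_mul hj)
    rw [hω.2, hs.tsum_eq_add_tsum_ite k, hB]
    ring
  have hTk : 0 < P {ω | 1 < |Tv [] k ω|} := by
    have hid : IdentDistrib (Tv [] k) (T k) P μ :=
      (hm.identDistrib_T []).comp (measurable_pi_apply k)
    have := hid.measure_mem_eq (s := {x : ℝ | 1 < |x|})
      (measurableSet_lt measurable_const (by fun_prop))
    exact hk.trans_eq this.symm
  exact lintegral_exp_abs_eq_top_of_affine (hσB.mono hle le_rfl).aemeasurable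
    (hm.measurable_T [] k).aemeasurable hind ((hm.subtree k).identDistrib_canonicalW hm) heq hTk
    (hm.not_ae_eq_const hN hC hp hC0 hC1 hCp hT) hθ

end IsWeightedBranchingModel

variable {X : Ω → ℝ}

/-- Finite exponential moments on both sides of zero would give one for `|X|` at `θ = min a (-b)`.
-/
lemma not_mem_integrableExpSet_of_pos_of_neg
    (h : ∀ θ : ℝ, 0 < θ → ∫⁻ ω, ENNReal.ofReal (Real.exp (θ * |X ω|)) ∂P = ⊤)
    {a b : ℝ} (ha : 0 < a) (hb : b < 0) (haX : a ∈ integrableExpSet X P) :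
    b ∉ integrableExpSet X P := by
  intro hbX
  have hθ : 0 < min a (-b) := lt_min ha (neg_pos.mpr hb)
  have h1 : Integrable (fun ω => Real.exp (min a (-b) * X ω)) P :=
    integrable_exp_mul_of_nonneg_of_le haX hθ.le (min_le_left _ _)
  have h2 : Integrable (fun ω => Real.exp (-min a (-b) * X ω)) P :=
    integrable_exp_mul_of_nonpos_of_ge hbX (by linarith) (by linarith [min_le_right a (-b)])
  have h3 := (hasFiniteIntegral_iff_ofReal (ae_of_all _ fun ω => (Real.exp_pos _).le)).mp
    (integrable_exp_mul_abs h1 h2).2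
  exact h3.ne (h _ hθ)

lemma integrableExpSet_notMem_nhds_zero
    (h : ∀ θ : ℝ, 0 < θ → ∫⁻ ω, ENNReal.ofReal (Real.exp (θ * |X ω|)) ∂P = ⊤) :
    integrableExpSet X P ∉ 𝓝 (0 : ℝ) := by
  intro hn
  obtain ⟨ε, hε, hball⟩ := Metric.mem_nhds_iff.mp hn
  refine not_mem_integrableExpSet_of_pos_of_neg h (a := ε / 2) (b := -(ε / 2)) (by linarith)
    (by linarith) (hball ?_) (hball ?_)
  all_goals
    simp only [Metric.mem_ball, Real.dist_eq, sub_zero, abs_neg]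
    rw [abs_of_pos] <;> linarith

lemma integrableExpSet_inter_eq_singleton
    (h : ∀ θ : ℝ, 0 < θ → ∫⁻ ω, ENNReal.ofReal (Real.exp (θ * |X ω|)) ∂P = ⊤) :
    integrableExpSet X P ∩ Set.Ici 0 = {0} ∨ integrableExpSet X P ∩ Set.Iic 0 = {0} := by
  have h0 : (0 : ℝ) ∈ integrableExpSet X P := by simp [integrableExpSet]
  by_cases hpos : ∃ a, 0 < a ∧ a ∈ integrableExpSet X P
  · obtain ⟨a, ha, haX⟩ := hpos
    refine Or.inr (Set.eq_singleton_iff_unique_mem.mpr ⟨⟨h0, Set.self_mem_Iic⟩, fun b hb => ?_⟩)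
    by_contra hne
    exact not_mem_integrableExpSet_of_pos_of_neg h ha (lt_of_le_of_ne hb.2 hne) haX hb.1
  · refine Or.inl (Set.eq_singleton_iff_unique_mem.mpr ⟨⟨h0, Set.self_mem_Ici⟩, fun b hb => ?_⟩)
    by_contra hne
    exact hpos ⟨b, lt_of_le_of_ne hb.2 (Ne.symm hne), hb.1⟩

end ExponentialMoments

end SmoothingTransform

end

theorem proposition3p1 {Ω₀ Ω : Type*} [MeasurableSpace Ω₀] [MeasurableSpace Ω]
    (μ : Measure Ω₀) [IsProbabilityMeasure μ] (P : Measure Ω) [IsProbabilityMeasure P]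
    (C : Ω₀ → ℝ) (T : ℕ → Ω₀ → ℝ) (hCm : Measurable C) (hTm : ∀ k, Measurable (T k))
    -- almost surely finitely many of the `T k` are nonzero, and `C` is nonzero
    (hN : ∀ᵐ ω ∂μ, {k | T k ω ≠ 0}.Finite)
    (hC : 0 < μ {ω | C ω ≠ 0})
    (Cv : List ℕ → Ω → ℝ) (Tv : List ℕ → ℕ → Ω → ℝ)
    (hmodel : SmoothingTransform.IsWeightedBranchingModel μ C T P Cv Tv)
    (p : ℝ) (hp : p ∈ Set.Icc (1 : ℝ) 2)
    (hC0 : ∫ ω, C ω ∂μ = 0)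
    (hCp : MemLp C (ENNReal.ofReal p) μ)
    (hT : ∫⁻ ω, SmoothingTransform.powerSum p (fun k => T k ω) ∂μ < 1)
    (hmax : 0 < μ {ω | 1 < ⨆ k, ENNReal.ofReal |T k ω|}) :
    (∀ᵐ ω ∂P, Tendsto (fun n => SmoothingTransform.partialW Cv Tv n ω) atTop
      (𝓝 (SmoothingTransform.canonicalW Cv Tv ω))) ∧
    (∀ θ : ℝ, 0 < θ →
      ∫⁻ ω, ENNReal.ofReal (Real.exp (θ * |SmoothingTransform.canonicalW Cv Tv ω|)) ∂P = ⊤) ∧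
    integrableExpSet (SmoothingTransform.canonicalW Cv Tv) P ∉ 𝓝 (0 : ℝ) ∧
    (integrableExpSet (SmoothingTransform.canonicalW Cv Tv) P ∩ Set.Ici 0 = {0} ∨
      integrableExpSet (SmoothingTransform.canonicalW Cv Tv) P ∩ Set.Iic 0 = {0}) := by
  have hCr : Integrable C μ :=
    hCp.integrable (by simpa using ENNReal.ofReal_le_ofReal hp.1)
  have hCi : Integrable (fun ω => |C ω| ^ p) μ := by
    have hp0 : 0 < p := by linarith [hp.1]
    have := hCp.integrable_norm_rpow (by simpa using hp0) ENNReal.ofReal_ne_top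
    simpa only [ENNReal.toReal_ofReal hp0.le, Real.norm_eq_abs] using this
  -- A supremum above `1` is exceeded by a single index, and a countable union of null events is
  -- null.
  obtain ⟨k, hk⟩ : ∃ k, 0 < μ {ω | 1 < |T k ω|} := by
    by_contra! hcon
    refine hmax.ne' (measure_mono_null (t := ⋃ k, {ω | 1 < |T k ω|}) (fun ω hω => ?_)
      (measure_iUnion_null fun k => le_antisymm (hcon k) zero_le))
    obtain ⟨k, hk⟩ := lt_iSup_iff.mp (show 1 < ⨆ k, ENNReal.ofReal |T k ω| from hω)
    exact Set.mem_iUnion.mpr ⟨k, ENNReal.one_lt_ofReal.mp hk⟩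
  have hexp := fun θ (hθ : 0 < θ) =>
    hmodel.lintegral_exp_abs_canonicalW hN hC hp hC0 hCr hCi hT hk hθ
  exact ⟨hmodel.ae_tendsto_partialW hN hp hC0 hCr hCi hT, hexp,
    SmoothingTransform.integrableExpSet_notMem_nhds_zero hexp,
    SmoothingTransform.integrableExpSet_inter_eq_singleton hexp⟩
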